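/- Let $G$ be a connected (finite-dimensional, real) Lie group with Lie algebra $\mathfrak g$, let $\tau^G$ be an involutive Lie group automorphism of $G$ (i.e. $\tau^G\circ\tau^G=\mathrm{id}_G$), let $\tau = L(\tau^G)$ be its derivative on $\mathfrak g$, and put $\mathfrak h = \mathfrak g^{\tau} = \{x \in \mathfrak g : \tau(x) = x\}$. Let $H$ be an open subgroup of the fixed-point group $G^{\tau^G}$ and let $M = G/H$. Let $h \in \mathfrak h$ be an Euler element, i.e. $\operatorname{ad} h$ is non-zero and diagonalizable with $\operatorname{Spec}(\operatorname{ad} h) \subseteq \{-1,0,1\}$. Let $\alpha_t(m) = \exp(th)\,m$ $(t \in \mathbb R,\ m \in M)$ be the modular flow on $M$, let $X_h^M(m) = \frac{d}{dt}\big|_{t=0}\alpha_t(m)$ be the modular vector field, and let $M^\alpha = \{m \in M : \alpha_t(m) = m \text{ for all } t \in \mathbb R\}$. Let $G^h = \{g \in G : \operatorname{Ad}(g)h = h\}$ and let $G^h_e$ be its identity component. Then $$M^\alpha = \{gH \in M : \operatorname{Ad}(g)^{-1}h \in \mathfrak h\} = \{m \in M : X_h^M(m) = 0\},$$ and the orbits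 of $G^h_e$ on $M^\alpha$ coincide with the connected components of $M^\alpha$: for every $m \in M^\alpha$, the orbit $G^h_e.m$ is the connected component of $M^\alpha$ containing $m$. -/

import Mathlib

open scoped Manifold ContDiff

noncomputable section

namespace ModularFlow

/-- An Euler element of a real Lie algebra: `ad h` is non-zero, diagonalizable, and its spectrum is
contained in `{-1, 0, 1}`. -/
def IsEulerElement {L : Type*} [LieRing L] [LieAlgebra ℝ L] (h : L) : Prop :=
  LieAlgebra.ad ℝ L h ≠ 0 ∧
    (⨆ c : ℝ, Module.End.eigenspace (LieAlgebra.ad ℝ L h) c) = ⊤ ∧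
    spectrum ℝ (LieAlgebra.ad ℝ L h) ⊆ {-1, 0, 1}

instance : ENat.LEInfty (minSmoothness ℝ 3) := ⟨by
  rw [minSmoothness_of_isRCLikeNormedField]
  exact ENat.LEInfty.out⟩

section LieGroups

variable {E : Type*} [NormedAddCommGroup E] [NormedSpace ℝ E]
  {G : Type*} [TopologicalSpace G] [ChartedSpace E G] [Group G]

/-- `L(φ) : 𝔤 → 𝔤`, the derivative at the identity of a group endomorphism `φ`
(the tangent spaces at `φ 1` and `1` agree since `φ 1 = 1`). -/
def lieMap (φ : G →* G) : GroupLieAlgebra 𝓘(ℝ, E) G →L[ℝ] GroupLieAlgebra 𝓘(ℝ, E) G :=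
  mfderiv 𝓘(ℝ, E) 𝓘(ℝ, E) φ 1

/-- The adjoint representation: `Ad g` is the derivative at `1` of `y ↦ g * y * g⁻¹`. -/
def Ad (g : G) : GroupLieAlgebra 𝓘(ℝ, E) G →L[ℝ] GroupLieAlgebra 𝓘(ℝ, E) G :=
  lieMap (MulAut.conj g).toMonoidHom

/-- The fixed-point algebra `𝔥 = 𝔤^τ` of the derivative of an endomorphism `τ` of `G`. -/
def fixedLie (τ : G →* G) : Submodule ℝ (GroupLieAlgebra 𝓘(ℝ, E) G) :=
  LinearMap.eqLocus (lieMap (E := E) τ).toLinearMap LinearMap.id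

/-- The fixed-point group `G^τ` of an endomorphism `τ` of `G`. -/
def fixedGroup (τ : G →* G) : Subgroup G :=
  MonoidHom.eqLocus τ (MonoidHom.id G)

lemma Ad_one : Ad (E := E) (1 : G) = ContinuousLinearMap.id ℝ _ := by
  have : ((MulAut.conj (1 : G)).toMonoidHom : G → G) = id := by ext; simp
  unfold Ad lieMap
  rw [this]
  exact mfderiv_id

variable [LieGroup 𝓘(ℝ, E) ∞ G]

lemma Ad_mul (a b : G) : Ad (E := E) (a * b) = (Ad a).comp (Ad b) := by
  have hd : ∀ c x : G, MDifferentiableAt 𝓘(ℝ, E) 𝓘(ℝ, E)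
      ((MulAut.conj c).toMonoidHom : G → G) x := by
    intro c x
    have : ContMDiff 𝓘(ℝ, E) 𝓘(ℝ, E) ∞ (fun y : G => c * y * c⁻¹) :=
      (contMDiff_const.mul contMDiff_id).mul contMDiff_const
    exact this.contMDiffAt.mdifferentiableAt (by simp)
  have : ((MulAut.conj (a * b)).toMonoidHom : G → G)
      = (MulAut.conj a).toMonoidHom ∘ (MulAut.conj b).toMonoidHom := by
    ext; simp [mul_assoc]
  unfold Ad lieMap
  rw [this, mfderiv_comp (I' := 𝓘(ℝ, E)) _ (hd _ _) (hd _ _)]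
  have h1 : ((MulAut.conj b).toMonoidHom : G → G) 1 = 1 := map_one _
  rw [h1]
  rfl

/-- The centralizer `G^h = {g ∈ G : Ad(g) h = h}`. -/
def centralizer (h : GroupLieAlgebra 𝓘(ℝ, E) G) : Subgroup G where
  carrier := {g | Ad g h = h}
  one_mem' := by simp [Ad_one]
  mul_mem' {a b} ha hb := by
    simp only [Set.mem_ofPred_eq] at *
    rw [Ad_mul, ContinuousLinearMap.comp_apply, hb, ha]
  inv_mem' {a} ha := by
    simp only [Set.mem_ofPred_eq] at *
    conv_lhs => rw [← ha]
    rw [← ContinuousLinearMap.comp_apply, ← Ad_mul, inv_mul_cancel, Ad_one,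
      ContinuousLinearMap.id_apply]

/-- The identity component `G^h_e` of the topological group `G^h`, as a subgroup of `G`. -/
def centralizerComponent (h : GroupLieAlgebra 𝓘(ℝ, E) G) : Subgroup G :=
  haveI : IsTopologicalGroup G := topologicalGroup_of_lieGroup 𝓘(ℝ, E) ∞
  (Subgroup.connectedComponentOfOne (centralizer h)).map (centralizer h).subtype

lemma mulInvariantVectorField_mul (x : GroupLieAlgebra 𝓘(ℝ, E) G) (g a : G) :
    mfderiv 𝓘(ℝ, E) 𝓘(ℝ, E) (fun y : G => g * y) a (mulInvariantVectorField x a)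
      = mulInvariantVectorField x (g * a) := by
  have hd : ∀ c y : G, MDifferentiableAt 𝓘(ℝ, E) 𝓘(ℝ, E) (fun z : G => c * z) y := fun c y =>
    (contMDiff_mul_left (I := 𝓘(ℝ, E)) (n := ∞)).contMDiffAt.mdifferentiableAt (by simp)
  have hc : (fun y : G => g * a * y) = (fun y : G => g * y) ∘ (fun y : G => a * y) := by
    ext; simp [mul_assoc]
  have key := mfderiv_comp (I := 𝓘(ℝ, E)) (I' := 𝓘(ℝ, E)) (I'' := 𝓘(ℝ, E)) (1 : G)
    (hd g (a * 1)) (hd a 1)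
  rw [← hc, mul_one] at key
  exact (congrArg (fun T => T x) key).symm

variable [FiniteDimensional ℝ E]

/-- Every left-invariant vector field has a global integral curve through the identity. -/
theorem exists_integralCurve (x : GroupLieAlgebra 𝓘(ℝ, E) G) :
    ∃ γ : ℝ → G, γ 0 = 1 ∧
      IsMIntegralCurve (I := 𝓘(ℝ, E)) γ (mulInvariantVectorField x) := by
  have : CompleteSpace E := FiniteDimensional.complete ℝ E
  have : IsTopologicalGroup G := topologicalGroup_of_lieGroup 𝓘(ℝ, E) ∞
  have : T1Space G := 𝓘(ℝ, E).t1Space G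
  have hv : ContMDiff 𝓘(ℝ, E) 𝓘(ℝ, E).tangent 1
      (fun g : G => (⟨g, mulInvariantVectorField x g⟩ : TangentBundle 𝓘(ℝ, E) G)) :=
    (contMDiff_mulInvariantVectorField x).of_le
      (le_trans (by norm_num) (le_minSmoothness (𝕜 := ℝ)))
  obtain ⟨γ, h0, hγ⟩ := exists_isMIntegralCurveAt_of_contMDiffAt_boundaryless
    (I := 𝓘(ℝ, E)) 0 (hv.contMDiffAt (x := (1 : G)))
  obtain ⟨ε, hε, hγ⟩ := isMIntegralCurveAt_iff'.1 hγ
  rw [Real.ball_eq_Ioo, zero_sub, zero_add] at hγ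
  refine exists_isMIntegralCurve_of_isMIntegralCurveOn hv hε (fun g => ?_) 1
  refine ⟨fun t => g * γ t, by simp [h0], fun t ht => ?_⟩
  have hd : MDifferentiableAt 𝓘(ℝ, E) 𝓘(ℝ, E) (fun z : G => g * z) (γ t) :=
    (contMDiff_mul_left (I := 𝓘(ℝ, E)) (n := ∞)).contMDiffAt.mdifferentiableAt (by simp)
  have key := hd.hasMFDerivAt.comp_hasMFDerivWithinAt t (hγ t ht)
  refine key.congr_mfderiv ?_
  refine ContinuousLinearMap.ext fun (r : ℝ) => ?_
  change mfderiv 𝓘(ℝ, E) 𝓘(ℝ, E) (fun z : G => g * z) (γ t)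
    (r • mulInvariantVectorField x (γ t)) = r • mulInvariantVectorField x (g * γ t)
  rw [map_smul, mulInvariantVectorField_mul]

/-- The exponential function of `G`: `exp x` is the value at time `1` of the integral curve,
starting at the identity, of the left-invariant vector field defined by `x`. -/
def lieExp (x : GroupLieAlgebra 𝓘(ℝ, E) G) : G :=
  (exists_integralCurve x).choose 1

/-- The modular flow `α_t(m) = exp(t h) m` on `M = G ⧸ H`. -/
def modularFlow (h : GroupLieAlgebra 𝓘(ℝ, E) G) (H : Subgroup G) (t : ℝ) (m : G ⧸ H) : G ⧸ H :=
  lieExp (t • h) • m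

/-- The fixed-point set `M^α` of the modular flow on `M = G ⧸ H`. -/
def fixedSet (h : GroupLieAlgebra 𝓘(ℝ, E) G) (H : Subgroup G) : Set (G ⧸ H) :=
  {m | ∀ t : ℝ, modularFlow h H t m = m}

variable (E) in
/-- The smooth functions on the homogeneous space `G ⧸ H`. As the projection `G → G ⧸ H` is a
surjective submersion, `f` is smooth if and only if its pullback to `G` is. -/
def smoothFunctions (H : Subgroup G) : Set ((G ⧸ H) → ℝ) :=
  {f | ContMDiff 𝓘(ℝ, E) 𝓘(ℝ, ℝ) ∞ (fun g : G => f (g : G ⧸ H))}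

/-- The value at `m` of the modular vector field `X_h^M`, the tangent vector
`d/dt|_{t = 0} α_t(m)` at `m`, given as usual by the directional derivative
`f ↦ d/dt|_{t = 0} f(α_t(m))` that it defines on the smooth functions of `M = G ⧸ H`. -/
def modularVectorField (h : GroupLieAlgebra 𝓘(ℝ, E) G) (H : Subgroup G) (m : G ⧸ H) :
    smoothFunctions E H → ℝ :=
  fun f => deriv (fun t : ℝ => f.1 (modularFlow h H t m)) 0

end LieGroups

end ModularFlow

end

/-! Everything rests on `exp(th) g = g exp(t Ad(g)⁻¹h)`: the point `gH` is fixed iff the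
one-parameter group of `y = Ad(g)⁻¹h` stays in `H`. Since `H` is clopen in `G^τ` and `ℝ` is
connected, this means `τ y = y`. For the zeros of the vector field, `a ↦ a τ(a)⁻¹` is constant on
the cosets `aH`. Along the flow, up to fixed translations, it is `exp(ty) exp(-tτy)`, with velocity
`y - τy`. If that is nonzero, a bump function detects it (`modularVectorField_ne_zero`). For the
orbits, `aH` is fixed iff `a τ(a)⁻¹ ∈ G^h`. Near a fixed `gH`, write points as `ugH` and let `σ` be
`τ` conjugated by `g`; then `ugH` is fixed iff `u σ(u)⁻¹ ∈ G^h`. A small square root `v` of this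
element satisfies `σ(v) = v⁻¹`, so `v⁻¹u` is `σ`-fixed and `ugH = vgH`. Moreover `v ∈ G^h`, because
`Ad v` has no eigenvalue `-1`, and then `v ∈ G^h_e`, because the orbit map of `h` has constant rank.
Hence the orbits of `G^h_e` are relatively open in `M^α` (`eventually_mem_orbit`); being connected
and disjoint, they are its components. -/

open scoped Manifold ContDiff

noncomputable section

namespace ModularFlow

/-! ### One-parameter groups and the algebraic description of the fixed points. -/

section Exponential

variable {E : Type*} [NormedAddCommGroup E] [NormedSpace ℝ E]
  {G : Type*} [TopologicalSpace G] [ChartedSpace E G] [Group G]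

lemma mulInvariantVectorField_one (x : GroupLieAlgebra 𝓘(ℝ, E) G) :
    mulInvariantVectorField x (1 : G) = x := by
  have : (fun y : G => 1 * y) = id := by ext; simp
  change mfderiv 𝓘(ℝ, E) 𝓘(ℝ, E) (fun y : G => 1 * y) 1 x = x
  rw [this]
  exact congrArg (fun T => T x) mfderiv_id

variable [LieGroup 𝓘(ℝ, E) ∞ G]

variable (E G) in
lemma t2Space_of_lieGroup [FiniteDimensional ℝ E] : T2Space G := by
  have : CompleteSpace E := FiniteDimensional.complete ℝ E
  have : IsTopologicalGroup G := topologicalGroup_of_lieGroup 𝓘(ℝ, E) ∞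
  have : T1Space G := 𝓘(ℝ, E).t1Space G
  infer_instance

lemma mdifferentiableAt_mul_left (c y : G) :
    MDifferentiableAt 𝓘(ℝ, E) 𝓘(ℝ, E) (fun z : G => c * z) y :=
  (contMDiff_mul_left (I := 𝓘(ℝ, E)) (n := ∞)).contMDiffAt.mdifferentiableAt (by simp)

lemma contMDiff_conj (g : G) :
    ContMDiff 𝓘(ℝ, E) 𝓘(ℝ, E) ∞ ((MulAut.conj g).toMonoidHom : G → G) :=
  (contMDiff_const.mul contMDiff_id).mul contMDiff_const

lemma contMDiff_one_mulInvariantVectorField (x : GroupLieAlgebra 𝓘(ℝ, E) G) :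
    ContMDiff 𝓘(ℝ, E) 𝓘(ℝ, E).tangent 1
      (fun g : G => (⟨g, mulInvariantVectorField x g⟩ : TangentBundle 𝓘(ℝ, E) G)) :=
  (contMDiff_mulInvariantVectorField x).of_le
    (le_trans (by norm_num) (le_minSmoothness (𝕜 := ℝ)))

/-- Differentiate `φ ∘ L_g = L_{φ g} ∘ φ` at `1`. -/
lemma mfderiv_mulInvariantVectorField (φ : G →* G) (hφ : ContMDiff 𝓘(ℝ, E) 𝓘(ℝ, E) ∞ φ)
    (x : GroupLieAlgebra 𝓘(ℝ, E) G) (g : G) :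
    mfderiv 𝓘(ℝ, E) 𝓘(ℝ, E) φ g (mulInvariantVectorField x g)
      = mulInvariantVectorField (lieMap φ x) (φ g) := by
  have hd : ∀ y, MDifferentiableAt 𝓘(ℝ, E) 𝓘(ℝ, E) φ y := fun y =>
    hφ.contMDiffAt.mdifferentiableAt (by simp)
  have hc : φ ∘ (fun y : G => g * y) = (fun y : G => φ g * y) ∘ φ := by
    ext; simp
  have k1 := mfderiv_comp (I := 𝓘(ℝ, E)) (I' := 𝓘(ℝ, E)) (I'' := 𝓘(ℝ, E)) (1 : G)
    (hd (g * 1)) (mdifferentiableAt_mul_left g 1)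
  have k2 := mfderiv_comp (I := 𝓘(ℝ, E)) (I' := 𝓘(ℝ, E)) (I'' := 𝓘(ℝ, E)) (1 : G)
    (mdifferentiableAt_mul_left (φ g) (φ 1)) (hd 1)
  rw [hc, k2, mul_one, map_one] at k1
  exact (congrArg (fun T => T x) k1).symm

lemma isMIntegralCurve_map (φ : G →* G) (hφ : ContMDiff 𝓘(ℝ, E) 𝓘(ℝ, E) ∞ φ)
    {x : GroupLieAlgebra 𝓘(ℝ, E) G} {γ : ℝ → G}
    (hγ : IsMIntegralCurve (I := 𝓘(ℝ, E)) γ (mulInvariantVectorField x)) :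
    IsMIntegralCurve (I := 𝓘(ℝ, E)) (φ ∘ γ) (mulInvariantVectorField (lieMap φ x)) := by
  intro t
  have hd : MDifferentiableAt 𝓘(ℝ, E) 𝓘(ℝ, E) φ (γ t) :=
    hφ.contMDiffAt.mdifferentiableAt (by simp)
  refine (hd.hasMFDerivAt.comp t (hγ t)).congr_mfderiv ?_
  refine ContinuousLinearMap.ext fun (r : ℝ) => ?_
  change mfderiv 𝓘(ℝ, E) 𝓘(ℝ, E) φ (γ t) (r • mulInvariantVectorField x (γ t))
    = r • mulInvariantVectorField (lieMap φ x) (φ (γ t))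
  rw [map_smul, mfderiv_mulInvariantVectorField φ hφ]

lemma isMIntegralCurve_mul_left (g : G) {x : GroupLieAlgebra 𝓘(ℝ, E) G} {γ : ℝ → G}
    (hγ : IsMIntegralCurve (I := 𝓘(ℝ, E)) γ (mulInvariantVectorField x)) :
    IsMIntegralCurve (I := 𝓘(ℝ, E)) (fun t => g * γ t) (mulInvariantVectorField x) := by
  intro t
  refine ((mdifferentiableAt_mul_left g (γ t)).hasMFDerivAt.comp t (hγ t)).congr_mfderiv ?_
  refine ContinuousLinearMap.ext fun (r : ℝ) => ?_
  change mfderiv 𝓘(ℝ, E) 𝓘(ℝ, E) (fun z : G => g * z) (γ t)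
    (r • mulInvariantVectorField x (γ t)) = r • mulInvariantVectorField x (g * γ t)
  rw [map_smul, mulInvariantVectorField_mul]

variable [FiniteDimensional ℝ E]

lemma integralCurve_unique {x : GroupLieAlgebra 𝓘(ℝ, E) G} {γ δ : ℝ → G}
    (hγ : IsMIntegralCurve (I := 𝓘(ℝ, E)) γ (mulInvariantVectorField x))
    (hδ : IsMIntegralCurve (I := 𝓘(ℝ, E)) δ (mulInvariantVectorField x)) (h : γ 0 = δ 0) :
    γ = δ := by
  have : CompleteSpace E := FiniteDimensional.complete ℝ E
  have : T2Space G := t2Space_of_lieGroup E G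
  exact isMIntegralCurve_Ioo_eq_of_contMDiff_boundaryless
    (contMDiff_one_mulInvariantVectorField x) hγ hδ h

/-- Frees `lieExp` from the choice in its definition: `s ↦ γ (s t)` is an integral curve for `t •
x`, and uniqueness compares the two at time `1`. -/
lemma lieExp_smul_eq {x : GroupLieAlgebra 𝓘(ℝ, E) G} {γ : ℝ → G}
    (hγ : IsMIntegralCurve (I := 𝓘(ℝ, E)) γ (mulInvariantVectorField x)) (h0 : γ 0 = 1) (t : ℝ) :
    lieExp (t • x) = γ t := by
  obtain ⟨hc0, hc⟩ := (exists_integralCurve (t • x)).choose_spec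
  have h1 : IsMIntegralCurve (I := 𝓘(ℝ, E)) (γ ∘ (· * t)) (mulInvariantVectorField (t • x)) := by
    rw [mulInvariantVectorField_smul]
    exact hγ.comp_mul t
  have := congrFun (integralCurve_unique hc h1 (by simp [hc0, h0])) 1
  simpa [lieExp] using this

lemma isMIntegralCurve_lieExp (x : GroupLieAlgebra 𝓘(ℝ, E) G) :
    IsMIntegralCurve (I := 𝓘(ℝ, E)) (fun t : ℝ => (lieExp (t • x) : G))
      (mulInvariantVectorField x) := by
  obtain ⟨γ, h0, hγ⟩ := exists_integralCurve x
  have : (fun t : ℝ => (lieExp (t • x) : G)) = γ := funext fun t => lieExp_smul_eq hγ h0 t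
  rwa [this]

lemma lieExp_zero : lieExp (0 : GroupLieAlgebra 𝓘(ℝ, E) G) = 1 := by
  obtain ⟨γ, h0, hγ⟩ := exists_integralCurve (0 : GroupLieAlgebra 𝓘(ℝ, E) G)
  rw [← zero_smul ℝ (0 : GroupLieAlgebra 𝓘(ℝ, E) G), lieExp_smul_eq hγ h0, h0]

lemma map_lieExp_smul (φ : G →* G) (hφ : ContMDiff 𝓘(ℝ, E) 𝓘(ℝ, E) ∞ φ)
    (x : GroupLieAlgebra 𝓘(ℝ, E) G) (t : ℝ) :
    φ (lieExp (t • x)) = lieExp (t • lieMap φ x) := by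
  refine (lieExp_smul_eq (isMIntegralCurve_map φ hφ (isMIntegralCurve_lieExp x)) ?_ t).symm
  simp [lieExp_zero]

lemma conj_lieExp_smul (g : G) (x : GroupLieAlgebra 𝓘(ℝ, E) G) (t : ℝ) :
    g * lieExp (t • x) * g⁻¹ = lieExp (t • Ad g x) :=
  map_lieExp_smul (MulAut.conj g).toMonoidHom (contMDiff_conj g) x t

lemma eq_of_forall_lieExp_smul_eq {x y : GroupLieAlgebra 𝓘(ℝ, E) G}
    (h : ∀ t : ℝ, (lieExp (t • x) : G) = lieExp (t • y)) : x = y := by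
  have hx := isMIntegralCurve_lieExp x 0
  have hy := isMIntegralCurve_lieExp y 0
  rw [← funext h] at hy
  have hu := hasMFDerivAt_unique hx hy
  have := congrArg (fun T => T (1 : ℝ)) hu
  change (1 : ℝ) • mulInvariantVectorField x (lieExp ((0 : ℝ) • x) : G)
    = (1 : ℝ) • mulInvariantVectorField y (lieExp ((0 : ℝ) • x) : G) at this
  rw [zero_smul, lieExp_zero, one_smul, one_smul] at this
  exact (mulInvariantVectorField_one x).symm.trans (this.trans (mulInvariantVectorField_one y))

lemma forall_map_lieExp_smul_eq_iff (φ : G →* G) (hφ : ContMDiff 𝓘(ℝ, E) 𝓘(ℝ, E) ∞ φ)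
    (x : GroupLieAlgebra 𝓘(ℝ, E) G) :
    (∀ t : ℝ, φ (lieExp (t • x)) = lieExp (t • x)) ↔ lieMap φ x = x := by
  simp only [map_lieExp_smul φ hφ]
  exact ⟨eq_of_forall_lieExp_smul_eq, fun h t => by rw [h]⟩

lemma continuous_lieExp_smul (x : GroupLieAlgebra 𝓘(ℝ, E) G) :
    Continuous fun t : ℝ => (lieExp (t • x) : G) :=
  (isMIntegralCurve_lieExp x).continuous

/-- An open subgroup is closed, so the times at which a one-parameter group of `G^τ` lies in `H`
form a clopen subset of `ℝ` containing `0`. -/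
lemma forall_lieExp_smul_mem_iff {τ : G →* G} (hτ : ContMDiff 𝓘(ℝ, E) 𝓘(ℝ, E) ∞ τ)
    {H : Subgroup G} (hH_le : H ≤ fixedGroup τ)
    (hH_open : IsOpen (H.subgroupOf (fixedGroup τ) : Set (fixedGroup τ)))
    (x : GroupLieAlgebra 𝓘(ℝ, E) G) :
    (∀ t : ℝ, lieExp (t • x) ∈ H) ↔ x ∈ fixedLie τ := by
  change _ ↔ lieMap τ x = x
  rw [← forall_map_lieExp_smul_eq_iff τ hτ]
  refine ⟨fun h t => hH_le (h t), fun h t => ?_⟩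
  have : IsTopologicalGroup G := topologicalGroup_of_lieGroup 𝓘(ℝ, E) ∞
  let c : ℝ → fixedGroup τ := fun t => ⟨lieExp (t • x), h t⟩
  have hc : Continuous c := (continuous_lieExp_smul x).subtype_mk _
  have hcl : IsClopen (c ⁻¹' (H.subgroupOf (fixedGroup τ) : Set (fixedGroup τ))) :=
    ⟨(Subgroup.isClosed_of_isOpen _ hH_open).preimage hc, hH_open.preimage hc⟩
  have h0 : (0 : ℝ) ∈ c ⁻¹' (H.subgroupOf (fixedGroup τ) : Set (fixedGroup τ)) := by
    change lieExp ((0 : ℝ) • x) ∈ H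
    rw [zero_smul, lieExp_zero]
    exact H.one_mem
  have := hcl.eq_univ ⟨0, h0⟩
  exact (this ▸ Set.mem_univ t : t ∈ c ⁻¹' (H.subgroupOf (fixedGroup τ) : Set (fixedGroup τ)))

lemma modularFlow_mk (h : GroupLieAlgebra 𝓘(ℝ, E) G) (H : Subgroup G) (t : ℝ) (g : G) :
    modularFlow h H t (g : G ⧸ H) = ((g * lieExp (t • Ad g⁻¹ h) : G) : G ⧸ H) := by
  rw [← conj_lieExp_smul g⁻¹ h t]
  change ((lieExp (t • h) * g : G) : G ⧸ H) = _
  congr 1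
  group

lemma mk_mem_fixedSet_iff {τ : G →* G} (hτ : ContMDiff 𝓘(ℝ, E) 𝓘(ℝ, E) ∞ τ)
    {H : Subgroup G} (hH_le : H ≤ fixedGroup τ)
    (hH_open : IsOpen (H.subgroupOf (fixedGroup τ) : Set (fixedGroup τ)))
    (h : GroupLieAlgebra 𝓘(ℝ, E) G) (g : G) :
    (g : G ⧸ H) ∈ fixedSet h H ↔ Ad g⁻¹ h ∈ fixedLie τ := by
  rw [← forall_lieExp_smul_mem_iff hτ hH_le hH_open]
  refine forall_congr' fun t => ?_
  rw [modularFlow_mk, eq_comm, QuotientGroup.eq, inv_mul_cancel_left]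

lemma fixedSet_eq {τ : G →* G} (hτ : ContMDiff 𝓘(ℝ, E) 𝓘(ℝ, E) ∞ τ)
    {H : Subgroup G} (hH_le : H ≤ fixedGroup τ)
    (hH_open : IsOpen (H.subgroupOf (fixedGroup τ) : Set (fixedGroup τ)))
    (h : GroupLieAlgebra 𝓘(ℝ, E) G) :
    fixedSet h H = {m | ∃ g : G, (g : G ⧸ H) = m ∧ Ad g⁻¹ h ∈ fixedLie τ} := by
  ext m
  constructor
  · induction m using QuotientGroup.induction_on with
    | _ g => exact fun hm => ⟨g, rfl, (mk_mem_fixedSet_iff hτ hH_le hH_open h g).1 hm⟩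
  · rintro ⟨g, rfl, hg⟩
    exact (mk_mem_fixedSet_iff hτ hH_le hH_open h g).2 hg

end Exponential

/-! ### The product rule at the identity. -/

section Product

variable {E : Type*} [NormedAddCommGroup E] [NormedSpace ℝ E]
  {G : Type*} [TopologicalSpace G] [ChartedSpace E G] [Group G] [LieGroup 𝓘(ℝ, E) ∞ G]
  {E' : Type*} [NormedAddCommGroup E'] [NormedSpace ℝ E']
  {M : Type*} [TopologicalSpace M] [ChartedSpace E' M]

/-- Both partial maps of multiplication at `(1, 1)` are the identity. -/
lemma hasMFDerivAt_mul_of_eq_one {a b : M → G} {x : M} {a' b' : E' →L[ℝ] E}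
    (ha : HasMFDerivAt 𝓘(ℝ, E') 𝓘(ℝ, E) a x a') (hb : HasMFDerivAt 𝓘(ℝ, E') 𝓘(ℝ, E) b x b')
    (ha1 : a x = 1) (hb1 : b x = 1) :
    HasMFDerivAt 𝓘(ℝ, E') 𝓘(ℝ, E) (fun y => a y * b y) x (a' + b' : E' →L[ℝ] E) := by
  have hm : MDifferentiableAt (𝓘(ℝ, E).prod 𝓘(ℝ, E)) 𝓘(ℝ, E)
      (fun p : G × G => p.1 * p.2) (a x, b x) :=
    (contMDiff_mul 𝓘(ℝ, E) ∞).contMDiffAt.mdifferentiableAt (by simp)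
  refine (hm.hasMFDerivAt.comp x (ha.prodMk hb)).congr_mfderiv ?_
  refine ContinuousLinearMap.ext fun (r : E') => ?_
  change mfderiv (𝓘(ℝ, E).prod 𝓘(ℝ, E)) 𝓘(ℝ, E) (fun p : G × G => p.1 * p.2) (a x, b x)
    (a' r, b' r) = a' r + b' r
  refine (mfderiv_prod_eq_add_apply hm).trans ?_
  have e1 : (fun z : G => z * b x) = id := by ext; simp [hb1]
  have e2 : (fun z : G => a x * z) = id := by ext; simp [ha1]
  change mfderiv 𝓘(ℝ, E) 𝓘(ℝ, E) (fun z : G => z * b x) (a x) (a' r)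
    + mfderiv 𝓘(ℝ, E) 𝓘(ℝ, E) (fun z : G => a x * z) (b x) (b' r) = _
  rw [e1, e2, mfderiv_id, mfderiv_id]
  rfl

end Product

/-! ### Smooth functions detecting a nonzero velocity. -/

section TestFunctions

variable {E : Type*} [NormedAddCommGroup E] [NormedSpace ℝ E] [FiniteDimensional ℝ E]
  {M : Type*} [TopologicalSpace M] [ChartedSpace E M] [IsManifold 𝓘(ℝ, E) ∞ M] [T2Space M]

lemma exists_contMDiff_hasDerivAt_ne_zero {c : ℝ → M} {w : E} (hw : w ≠ 0)
    (hc : HasMFDerivAt 𝓘(ℝ, ℝ) 𝓘(ℝ, E) c 0 ((1 : ℝ →L[ℝ] ℝ).smulRight w)) :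
    ∃ ψ : M → ℝ, ContMDiff 𝓘(ℝ, E) 𝓘(ℝ, ℝ) ∞ ψ ∧ ∃ r : ℝ, r ≠ 0 ∧
      HasDerivAt (fun t => ψ (c t)) r 0 := by
  obtain ⟨l, hl⟩ := SeparatingDual.exists_ne_zero (R := ℝ) hw
  obtain ⟨b⟩ : Nonempty (SmoothBumpFunction 𝓘(ℝ, E) (c 0)) := inferInstance
  -- A linear coordinate with `l w ≠ 0`, cut off by a bump function equal to `1` near `c 0`.
  refine ⟨fun x => b x • l (extChartAt 𝓘(ℝ, E) (c 0) x), ?_, l w, hl, ?_⟩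
  · refine b.contMDiff_smul ?_
    exact l.contDiff.contMDiff.comp_contMDiffOn (contMDiffOn_extChartAt (n := ∞))
  · have h1 : HasDerivAt (fun t => extChartAt 𝓘(ℝ, E) (c 0) (c t)) w 0 := by
      have h2 : HasFDerivWithinAt (fun t => extChartAt 𝓘(ℝ, E) (c 0) (c t))
        ((1 : ℝ →L[ℝ] ℝ).smulRight w) (Set.range id) 0 := hc.2
      rw [Set.range_id, hasFDerivWithinAt_univ] at h2
      simpa using h2.hasDerivAt
    have h2 : HasDerivAt (fun t => l (extChartAt 𝓘(ℝ, E) (c 0) (c t))) (l w) 0 :=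
      l.hasFDerivAt.comp_hasDerivAt 0 h1
    refine h2.congr_of_eventuallyEq ?_
    filter_upwards [hc.1.eventually b.eventuallyEq_one] with t ht
    simp [ht]

end TestFunctions

/-! ### Zeros of the modular vector field. -/

section VectorField

variable {E : Type*} [NormedAddCommGroup E] [NormedSpace ℝ E] [FiniteDimensional ℝ E]
  {G : Type*} [TopologicalSpace G] [ChartedSpace E G] [Group G] [LieGroup 𝓘(ℝ, E) ∞ G]

lemma hasMFDerivAt_lieExp_smul (x : GroupLieAlgebra 𝓘(ℝ, E) G) :
    HasMFDerivAt 𝓘(ℝ, ℝ) 𝓘(ℝ, E) (fun t : ℝ => (lieExp (t • x) : G)) 0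
      ((1 : ℝ →L[ℝ] ℝ).smulRight (x : E)) := by
  refine (isMIntegralCurve_lieExp x 0).congr_mfderiv ?_
  have h : ∀ g : G, g = 1 → (mulInvariantVectorField x g : E) = x := by
    rintro g rfl
    exact mulInvariantVectorField_one x
  exact congrArg (fun v : E => (1 : ℝ →L[ℝ] ℝ).smulRight v) (h _ (by simp [lieExp_zero]))

lemma lieExp_add_smul (x : GroupLieAlgebra 𝓘(ℝ, E) G) (s t : ℝ) :
    (lieExp ((s + t) • x) : G) = lieExp (s • x) * lieExp (t • x) := by
  have h1 := (isMIntegralCurve_lieExp x).comp_add s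
  have h2 := isMIntegralCurve_mul_left (lieExp (s • x)) (isMIntegralCurve_lieExp x)
  have := congrFun (integralCurve_unique h1 h2 (by simp [lieExp_zero])) t
  simpa [add_comm] using this

lemma lieExp_smul_neg (x : GroupLieAlgebra 𝓘(ℝ, E) G) (t : ℝ) :
    (lieExp (t • -x) : G) = (lieExp (t • x))⁻¹ := by
  rw [eq_inv_iff_mul_eq_one, smul_neg, ← neg_smul, ← lieExp_add_smul, neg_add_cancel, zero_smul,
    lieExp_zero]

lemma modularVectorField_ne_zero {τ : G →* G} (hτ : ContMDiff 𝓘(ℝ, E) 𝓘(ℝ, E) ∞ τ)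
    {H : Subgroup G} (hH : H ≤ fixedGroup τ) {h : GroupLieAlgebra 𝓘(ℝ, E) G} {g : G}
    (hg : Ad g⁻¹ h ∉ fixedLie τ) : modularVectorField h H (g : G ⧸ H) ≠ 0 := by
  have : T2Space G := t2Space_of_lieGroup E G
  set y := Ad g⁻¹ h with hy
  have hne : (y + -lieMap τ y : E) ≠ 0 := fun h0 => hg (add_neg_eq_zero.1 h0).symm
  have hinv (t : ℝ) : (lieExp (t • -lieMap τ y) : G) = (τ (lieExp (t • y)))⁻¹ := by
    rw [lieExp_smul_neg, map_lieExp_smul τ hτ]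
  have hd := hasMFDerivAt_mul_of_eq_one (hasMFDerivAt_lieExp_smul y)
    (hasMFDerivAt_lieExp_smul (-lieMap τ y)) (by simp [lieExp_zero]) (by simp [lieExp_zero])
  obtain ⟨ψ, hψ, r, hr, hder⟩ := exists_contMDiff_hasDerivAt_ne_zero (E := E) hne
    (hd.congr_mfderiv (ContinuousLinearMap.ext fun r : ℝ => (smul_add r (y : E) _).symm))
  -- The outer factors `g⁻¹` and `τ g` cancel along `a = g exp(ty)`, leaving the curve `exp(ty)
  -- exp(-tτy)` through `1`.
  let F : G → ℝ := fun a => ψ (g⁻¹ * (a * (τ a)⁻¹) * τ g)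
  have hF : ContMDiff 𝓘(ℝ, E) 𝓘(ℝ, ℝ) ∞ F := by
    refine hψ.comp ?_
    exact (contMDiff_const.mul (contMDiff_id.mul hτ.inv)).mul contMDiff_const
  have hFH (a b : G) (hab : QuotientGroup.leftRel H a b) : F a = F b := by
    rw [QuotientGroup.leftRel_apply] at hab
    have : τ (a⁻¹ * b) = a⁻¹ * b := hH hab
    have h2 : τ b = τ a * (a⁻¹ * b) := by rw [← this, map_mul, map_inv]; group
    change ψ (g⁻¹ * (a * (τ a)⁻¹) * τ g) = ψ (g⁻¹ * (b * (τ b)⁻¹) * τ g)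
    rw [h2]
    congr 2
    group
  let f : smoothFunctions E H := ⟨fun m => Quotient.lift F hFH m, hF⟩
  intro h0
  have h1 : deriv (fun t : ℝ => f.1 (modularFlow h H t (g : G ⧸ H))) 0 = 0 := congrFun h0 f
  refine hr (hder.deriv.symm.trans (Eq.trans ?_ h1))
  congr 1
  ext t
  rw [modularFlow_mk]
  change _ = F (g * lieExp (t • y))
  simp only [F]
  rw [hinv]
  congr 1
  rw [map_mul]
  group

lemma fixedSet_eq_modularVectorField {τ : G →* G} (hτ : ContMDiff 𝓘(ℝ, E) 𝓘(ℝ, E) ∞ τ)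
    {H : Subgroup G} (hH_le : H ≤ fixedGroup τ)
    (hH_open : IsOpen (H.subgroupOf (fixedGroup τ) : Set (fixedGroup τ)))
    (h : GroupLieAlgebra 𝓘(ℝ, E) G) :
    fixedSet h H = {m | modularVectorField h H m = 0} := by
  ext m
  constructor
  · intro hm
    funext f
    change deriv (fun t : ℝ => f.1 (modularFlow h H t m)) 0 = 0
    have hm' : ∀ t, modularFlow h H t m = m := hm
    simp [hm']
  · induction m using QuotientGroup.induction_on with
    | _ g =>
      intro hm
      rw [mk_mem_fixedSet_iff hτ hH_le hH_open]
      by_contra hg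
      exact modularVectorField_ne_zero hτ hH_le hg hm

end VectorField

/-! ### Level sets of maps of constant rank. -/

section ConstantRank

open Topology

lemma exists_generalized_inverse {E F : Type*} [NormedAddCommGroup E] [NormedSpace ℝ E]
    [FiniteDimensional ℝ E] [NormedAddCommGroup F] [NormedSpace ℝ F] [FiniteDimensional ℝ F]
    (L : E →L[ℝ] F) : ∃ S : F →L[ℝ] E, ∀ v, L (S (L v)) = L v := by
  obtain ⟨σ, hσ⟩ := L.toLinearMap.rangeRestrict.exists_rightInverse_of_surjective
    (LinearMap.range_rangeRestrict _)
  obtain ⟨S, hS⟩ := σ.exists_extend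
  refine ⟨S.toContinuousLinearMap, fun v => ?_⟩
  have h1 : S (L v) = σ (L.toLinearMap.rangeRestrict v) := by
    rw [← hS]; rfl
  have h2 := congrArg Subtype.val (LinearMap.congr_fun hσ (L.toLinearMap.rangeRestrict v))
  change L (S (L v)) = L v
  rw [h1]
  exact h2

/-- If the rank of the derivative of `f` does not exceed its value at `a` in a neighbourhood of
`a`, then the level set of `f` through `a` is locally path connected at `a`. -/
theorem eventually_joinedIn_level_of_rank_le {E F : Type*} [NormedAddCommGroup E]
    [NormedSpace ℝ E] [FiniteDimensional ℝ E] [NormedAddCommGroup F] [NormedSpace ℝ F]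
    [FiniteDimensional ℝ F] {f : E → F} {a : E} (hf : ContDiffAt ℝ 1 f a)
    (hrank : ∀ᶠ x in 𝓝 a, Module.finrank ℝ (fderiv ℝ f x).range
      ≤ Module.finrank ℝ (fderiv ℝ f a).range) {U : Set E} (hU : U ∈ 𝓝 a) :
    ∀ᶠ x in 𝓝 a, f x = f a → JoinedIn (U ∩ {y | f y = f a}) a x := by
  have : CompleteSpace E := FiniteDimensional.complete ℝ E
  set L := fderiv ℝ f a with hL
  obtain ⟨S, hS⟩ := exists_generalized_inverse L
  -- The derivative at `a` is `SL + (1 - SL) = 1`, so `φ` is a local diffeomorphism. As `LSL = L`,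
  -- it sends the level set of `f` into `a + ker L`.
  let φ : E → E := fun x => S (f x - f a) + (x - S (L (x - a)))
  have hφc : ContDiffAt ℝ 1 φ a := by
    have h1 : ContDiffAt ℝ 1 (fun x => S (f x - f a)) a :=
      S.contDiff.contDiffAt.comp a (hf.sub contDiffAt_const)
    have h2 : ContDiffAt ℝ 1 (fun x => S (L (x - a))) a :=
      (S ∘L L).contDiff.contDiffAt.comp a (contDiffAt_id.sub contDiffAt_const)
    exact h1.add (contDiffAt_id.sub h2)
  have hφd {x : E} (hx : DifferentiableAt ℝ f x) : HasFDerivAt φ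
      (S ∘L fderiv ℝ f x + (ContinuousLinearMap.id ℝ E - S ∘L L)) x := by
    have h1 : HasFDerivAt (fun x => S (f x - f a)) (S ∘L fderiv ℝ f x) x :=
      S.hasFDerivAt.comp x (hx.hasFDerivAt.sub_const _)
    have h2 : HasFDerivAt (fun x => S (L (x - a))) (S ∘L L) x := by
      have := (S ∘L L).hasFDerivAt.comp x ((hasFDerivAt_id x).sub_const a)
      exact this
    exact h1.add ((hasFDerivAt_id x).sub h2)
  have hφa : φ a = a := by simp [φ]
  have hd1 : HasFDerivAt φ ((ContinuousLinearEquiv.refl ℝ E : E ≃L[ℝ] E) : E →L[ℝ] E) a := by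
    convert hφd (hf.differentiableAt one_ne_zero) using 1
    ext v
    simp [hL]
  let Φ := hφc.toOpenPartialHomeomorph φ hd1 one_ne_zero
  have hΦ : (Φ : E → E) = φ := hφc.toOpenPartialHomeomorph_coe hd1 one_ne_zero
  have haS : a ∈ Φ.source := hφc.mem_toOpenPartialHomeomorph_source hd1 one_ne_zero
  have hdiff : ∀ᶠ x in 𝓝 a, DifferentiableAt ℝ f x :=
    (hf.eventually (by simp)).mono fun x hx => hx.differentiableAt one_ne_zero
  have hinv : ∀ᶠ x in 𝓝 a, IsUnit (fderiv ℝ φ x) := by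
    have hcont : ContinuousAt (fderiv ℝ φ) a := hφc.continuousAt_fderiv one_ne_zero
    refine hcont.eventually (Units.isOpen.mem_nhds ?_)
    rw [hd1.fderiv]
    exact isUnit_one
  have hgood : ∀ᶠ x in 𝓝 a, x ∈ U ∧ x ∈ Φ.source ∧ DifferentiableAt ℝ f x ∧
      IsUnit (fderiv ℝ φ x) ∧ Module.finrank ℝ (fderiv ℝ f x).range ≤ Module.finrank ℝ L.range := by
    filter_upwards [hU, Φ.open_source.mem_nhds haS, hdiff, hinv, hrank] with x h1 h2 h3 h4 h5
    exact ⟨h1, h2, h3, h4, h5⟩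
  -- the derivative of `f` vanishes on vectors mapped into `ker L` by the derivative of `φ`
  have hker {x w : E} (hx : DifferentiableAt ℝ f x) (hu : IsUnit (fderiv ℝ φ x))
      (hr : Module.finrank ℝ (fderiv ℝ f x).range ≤ Module.finrank ℝ L.range)
      (hw : L (fderiv ℝ φ x w) = 0) : fderiv ℝ f x w = 0 := by
    have hbij : Function.Bijective (fderiv ℝ φ x) := by
      obtain ⟨u, hu⟩ := hu
      rw [← hu]
      exact (ContinuousLinearEquiv.ofUnit u).bijective
    let e : E ≃ₗ[ℝ] E := LinearEquiv.ofBijective (fderiv ℝ φ x).toLinearMap hbij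
    let W : Submodule ℝ E := L.ker.comap e.toLinearMap
    -- `LSL = L` gives `L ∘ dφ_x = L S ∘ df_x`, hence this inclusion. The rank bound makes `ker
    -- df_x` at least as large as `ker L`, so the inclusion is an equality.
    have hsub : (fderiv ℝ f x).ker ≤ W := by
      intro v hv
      have hv' : fderiv ℝ f x v = 0 := hv
      change L (fderiv ℝ φ x v) = 0
      rw [(hφd hx).fderiv]
      simp [hv', hS]
    have hWdim : Module.finrank ℝ W = Module.finrank ℝ L.ker := by
      have : W = L.ker.map e.symm.toLinearMap := by
        rw [Submodule.map_equiv_eq_comap_symm]; rfl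
      rw [this]
      exact LinearEquiv.finrank_map_eq e.symm _
    have r1 := (fderiv ℝ f x).toLinearMap.finrank_range_add_finrank_ker
    have r2 := L.toLinearMap.finrank_range_add_finrank_ker
    have heq : (fderiv ℝ f x).ker = W := by
      refine Submodule.eq_of_le_of_finrank_le hsub ?_
      change Module.finrank ℝ (fderiv ℝ f x).range + Module.finrank ℝ (fderiv ℝ f x).ker = _ at r1
      change Module.finrank ℝ L.range + Module.finrank ℝ L.ker = _ at r2
      omega
    have : w ∈ W := hw
    rw [← heq] at this
    exact this
  have hsymm : ContinuousAt Φ.symm a := by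
    have := Φ.continuousAt_symm (Φ.map_source haS)
    rwa [hΦ, hφa] at this
  have hsa : Φ.symm a = a := by
    have := Φ.left_inv haS
    rwa [hΦ, hφa] at this
  have haT : a ∈ Φ.target := by
    have := Φ.map_source haS
    rwa [hΦ, hφa] at this
  have hball : ∀ᶠ y in 𝓝 a, y ∈ Φ.target ∧ (Φ.symm y ∈ U ∧ Φ.symm y ∈ Φ.source ∧
      DifferentiableAt ℝ f (Φ.symm y) ∧ IsUnit (fderiv ℝ φ (Φ.symm y)) ∧
      Module.finrank ℝ (fderiv ℝ f (Φ.symm y)).range ≤ Module.finrank ℝ L.range) := by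
    rw [← hsa] at hgood
    exact Filter.Eventually.and (Φ.open_target.mem_nhds haT) (hsymm.eventually hgood)
  obtain ⟨ε, hε, hb⟩ := Metric.eventually_nhds_iff_ball.1 hball
  have hφb : ∀ᶠ x in 𝓝 a, φ x ∈ Metric.ball a ε := by
    refine hφc.continuousAt.eventually ?_
    rw [hφa]
    exact Metric.ball_mem_nhds a hε
  filter_upwards [hφb, Φ.open_source.mem_nhds haS] with x hxb hxS hfx
  set k := φ x - a with hk
  have hLk : L k = 0 := by simp [hk, φ, hfx, hS, map_sub]
  have hline {t : ℝ} (ht : t ∈ Set.Icc (0 : ℝ) 1) : a + t • k ∈ Metric.ball a ε := by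
    rw [mem_ball_iff_norm, add_sub_cancel_left, norm_smul, Real.norm_eq_abs, abs_of_nonneg ht.1]
    rw [mem_ball_iff_norm] at hxb
    exact lt_of_le_of_lt (mul_le_of_le_one_left (norm_nonneg _) ht.2) hxb
  -- The segment from `a` to `φ x` has direction in `ker L`; pulled back by `φ`, it becomes a path
  -- along which `f` has zero derivative.
  let p : ℝ → E := fun t => Φ.symm (a + t • k)
  have hpd {t : ℝ} (ht : t ∈ Set.Icc (0 : ℝ) 1) : ∃ w : E, HasDerivAt p w t ∧
      fderiv ℝ f (p t) w = 0 := by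
    obtain ⟨hT, -, -, h3, h4, h5⟩ := hb _ (hline ht)
    obtain ⟨u, hu⟩ := h4
    have hdφ : HasFDerivAt Φ ((ContinuousLinearEquiv.ofUnit u : E ≃L[ℝ] E) : E →L[ℝ] E)
        (Φ.symm (a + t • k)) := by
      rw [hΦ]
      have h6 := (hφd h3).differentiableAt.hasFDerivAt
      rw [← hu] at h6
      exact h6
    have hs := Φ.hasFDerivAt_symm hT hdφ
    have hl : HasDerivAt (fun t : ℝ => a + t • k) k t := by
      simpa using ((hasDerivAt_id t).smul_const k).const_add a
    refine ⟨_, hs.comp_hasDerivAt t hl, hker h3 ⟨u, hu⟩ h5 ?_⟩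
    rw [← hu]
    change L ((ContinuousLinearEquiv.ofUnit u) ((ContinuousLinearEquiv.ofUnit u).symm k)) = 0
    rw [ContinuousLinearEquiv.apply_symm_apply, hLk]
  have hfp : ∀ t ∈ Set.Icc (0 : ℝ) 1, f (p t) = f (p 0) := by
    have hder {t : ℝ} (ht : t ∈ Set.Icc (0 : ℝ) 1) : HasDerivAt (fun t => f (p t)) 0 t := by
      obtain ⟨w, hw, h0⟩ := hpd ht
      have := (hb _ (hline ht)).2.2.2.1.hasFDerivAt.comp_hasDerivAt t hw
      rw [← h0]
      exact this
    exact constant_of_has_deriv_right_zero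
      (fun t ht => (hder ht).continuousAt.continuousWithinAt)
      (fun t ht => (hder (Set.Ico_subset_Icc_self ht)).hasDerivWithinAt)
  have hp0 : p 0 = a := by simp [p, hsa]
  refine JoinedIn.ofLine (f := p) (fun t ht => ?_) hp0 ?_ ?_
  · obtain ⟨w, hw, -⟩ := hpd ht
    exact hw.continuousAt.continuousWithinAt
  · have := Φ.left_inv hxS
    rw [hΦ] at this
    simp [p, hk, this]
  · rintro _ ⟨t, ht, rfl⟩
    exact ⟨(hb _ (hline ht)).2.1, (hfp t ht).trans (by rw [hp0])⟩

end ConstantRank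

section

open Topology

/-! ### Symmetric square roots near the identity. -/

section SquareRoots

/-- A local polar decomposition `u = v k` with `σ v = v⁻¹` and `σ k = k`, where `v` is the small
square root of `u (σ u)⁻¹`. In the application `K` is `G^h`, `K₀` is `G^h_e`, and `H` is a conjugate
of the stabilizer. -/
lemma eventually_exists_mul_fixed {G : Type*} [Group G] [TopologicalSpace G] [IsTopologicalGroup G]
    {σ : G →* G} (hσ : Continuous σ) (hσσ : ∀ g, σ (σ g) = g) {K : Set G} {K₀ H : Set G}
    (hsq : Filter.map (fun g : G => g * g) (𝓝 1) = 𝓝 1)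
    (hinj : ∃ V ∈ 𝓝 (1 : G), Set.InjOn (fun g : G => g * g) V)
    (hK : ∀ᶠ v in 𝓝 (1 : G), v * v ∈ K → v ∈ K₀)
    (hH : ∀ᶠ k in 𝓝 (1 : G), σ k = k → k ∈ H) :
    ∀ᶠ u in 𝓝 (1 : G), u * (σ u)⁻¹ ∈ K → ∃ v ∈ K₀, v⁻¹ * u ∈ H := by
  obtain ⟨V, hV, hVinj⟩ := hinj
  have h1 : ∀ᶠ p : G × G in 𝓝 1 ×ˢ 𝓝 1, σ (p.1⁻¹ * p.2) = p.1⁻¹ * p.2 → p.1⁻¹ * p.2 ∈ H := by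
    have hc : Filter.Tendsto (fun p : G × G => p.1⁻¹ * p.2) (𝓝 1 ×ˢ 𝓝 1) (𝓝 1) := by
      rw [← nhds_prod_eq]
      have : Continuous fun p : G × G => p.1⁻¹ * p.2 := by fun_prop
      simpa using this.tendsto (1, 1)
    exact hc.eventually hH
  obtain ⟨A, hA, B, hB, hAB⟩ := Filter.eventually_prod_iff.1 h1
  have h2 : ∀ᶠ v in 𝓝 (1 : G), A v ∧ v⁻¹ ∈ V ∧ σ v ∈ V ∧ (v * v ∈ K → v ∈ K₀) := by
    have hi : ∀ᶠ v in 𝓝 (1 : G), v⁻¹ ∈ V := by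
      have : Filter.Tendsto (fun v : G => v⁻¹) (𝓝 1) (𝓝 1) := by
        simpa using (continuous_inv (G := G)).tendsto 1
      exact this.eventually hV
    have hs : ∀ᶠ v in 𝓝 (1 : G), σ v ∈ V := by
      have : Filter.Tendsto σ (𝓝 1) (𝓝 1) := by simpa using hσ.tendsto 1
      exact this.eventually hV
    filter_upwards [hA, hi, hs, hK] with v a b c d
    exact ⟨a, b, c, d⟩
  have h3 : ∀ᶠ s in 𝓝 (1 : G), ∃ v, v * v = s ∧ A v ∧ v⁻¹ ∈ V ∧ σ v ∈ V ∧
      (v * v ∈ K → v ∈ K₀) := by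
    rw [← hsq, Filter.eventually_map]
    exact h2.mono fun v hv => ⟨v, rfl, hv⟩
  have hc : Filter.Tendsto (fun u : G => u * (σ u)⁻¹) (𝓝 1) (𝓝 1) := by
    have : Continuous fun u : G => u * (σ u)⁻¹ := by fun_prop
    simpa using this.tendsto 1
  filter_upwards [hc.eventually h3, hB] with u ⟨v, hvu, hv, hv1, hv2, hv3⟩ hu huK
  refine ⟨v, hv3 (hvu ▸ huK), hAB hv hu ?_⟩
  -- Both sides are small square roots of `(u (σ u)⁻¹)⁻¹`, and squaring is injective on `V`.
  have hσv : σ v = v⁻¹ := by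
    refine hVinj hv2 hv1 ?_
    change σ v * σ v = v⁻¹ * v⁻¹
    rw [← map_mul, hvu, ← mul_inv_rev, hvu, map_mul, map_inv, hσσ, mul_inv_rev, inv_inv]
  have h4 : u = v * (v * σ u) := by rw [← mul_assoc, hvu, inv_mul_cancel_right]
  change σ (v⁻¹ * u) = v⁻¹ * u
  rw [map_mul, map_inv, hσv, inv_inv]
  nth_rw 2 [h4]
  rw [inv_mul_cancel_left]

end SquareRoots

variable {E : Type*} [NormedAddCommGroup E] [NormedSpace ℝ E]
  {G : Type*} [TopologicalSpace G] [ChartedSpace E G] [Group G] [LieGroup 𝓘(ℝ, E) ∞ G]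

/-! ### Squaring is a local homeomorphism at the identity. -/

section Squaring

variable (E G) in
-- By the product rule, squaring has derivative `2 • id` at `1`, so the inverse function theorem
-- applies.
lemma exists_chart_squaring [FiniteDimensional ℝ E] :
    ∃ f : OpenPartialHomeomorph E E,
    extChartAt 𝓘(ℝ, E) (1 : G) 1 ∈ f.source ∧ ⇑f = fun x : E => extChartAt 𝓘(ℝ, E) (1 : G)
      ((extChartAt 𝓘(ℝ, E) (1 : G)).symm x * (extChartAt 𝓘(ℝ, E) (1 : G)).symm x) := by
  have : CompleteSpace E := FiniteDimensional.complete ℝ E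
  set e := extChartAt 𝓘(ℝ, E) (1 : G) with he
  have hes : ContMDiffAt 𝓘(ℝ, E) 𝓘(ℝ, E) ∞ e.symm (e 1) :=
    (contMDiffOn_extChartAt_symm (1 : G)).contMDiffAt (extChartAt_target_mem_nhds (1 : G))
  have hs : e.symm (e 1) = 1 := extChartAt_to_inv (1 : G)
  have hc : ContDiffAt ℝ ∞ (fun x : E => e (e.symm x * e.symm x)) (e 1) := by
    rw [← contMDiffAt_iff_contDiffAt]
    refine ContMDiffAt.comp (e 1) ?_ (hes.mul hes)
    rw [hs, mul_one]
    exact contMDiffAt_extChartAt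
  have hd : HasFDerivAt (fun x : E => e (e.symm x * e.symm x))
      ((ContinuousLinearEquiv.smulLeft (Units.mk0 (2 : ℝ) two_ne_zero) : E ≃L[ℝ] E) : E →L[ℝ] E)
      (e 1) := by
    have h := (hasMFDerivAt_mul_of_eq_one (a' := ContinuousLinearMap.id ℝ E)
      (b' := ContinuousLinearMap.id ℝ E) (hasMFDerivAt_id (I := 𝓘(ℝ, E)) (1 : G))
      (hasMFDerivAt_id (I := 𝓘(ℝ, E)) (1 : G)) rfl rfl).2
    have h2 : HasFDerivWithinAt (fun x : E => extChartAt 𝓘(ℝ, E) ((1 : G) * 1)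
      (e.symm x * e.symm x)) (ContinuousLinearMap.id ℝ E + ContinuousLinearMap.id ℝ E)
      (Set.range id) (e 1) := h
    rw [Set.range_id, hasFDerivWithinAt_univ, mul_one] at h2
    convert h2 using 1
    ext v
    exact two_smul ℝ v
  exact ⟨hc.toOpenPartialHomeomorph _ hd (by simp),
    hc.mem_toOpenPartialHomeomorph_source hd (by simp), hc.toOpenPartialHomeomorph_coe hd (by simp)⟩

lemma map_mul_self_nhds_one
    (E : Type*) [NormedAddCommGroup E] [NormedSpace ℝ E] [FiniteDimensional ℝ E]
    (G : Type*) [TopologicalSpace G] [ChartedSpace E G] [Group G] [LieGroup 𝓘(ℝ, E) ∞ G] :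
    Filter.map (fun g : G => g * g) (𝓝 1) = 𝓝 1 := by
  obtain ⟨f, hf, hfe⟩ := exists_chart_squaring E G
  set e := extChartAt 𝓘(ℝ, E) (1 : G) with he
  have he1 : Filter.map e (𝓝 1) = 𝓝 (e 1) := map_extChartAt_nhds_of_boundaryless (1 : G)
  have hsymm : Filter.map e.symm (𝓝 (e 1)) = 𝓝 1 := by
    rw [← he1, Filter.map_map]
    have : e.symm ∘ e =ᶠ[𝓝 1] id := by
      filter_upwards [extChartAt_source_mem_nhds (I := 𝓘(ℝ, E)) (1 : G)] with g hg
      exact e.left_inv hg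
    rw [Filter.map_congr this, Filter.map_id]
  have hfa : f (e 1) = e 1 := by
    rw [hfe]
    simp [he]
  have hsq : (fun g : G => g * g) =ᶠ[𝓝 1] e.symm ∘ f ∘ e := by
    have : IsTopologicalGroup G := topologicalGroup_of_lieGroup 𝓘(ℝ, E) ∞
    have hc : Filter.Tendsto (fun g : G => g * g) (𝓝 1) (𝓝 1) := by
      have : Continuous fun g : G => g * g := by fun_prop
      simpa using this.tendsto 1
    filter_upwards [extChartAt_source_mem_nhds (I := 𝓘(ℝ, E)) (1 : G),
      hc (extChartAt_source_mem_nhds (I := 𝓘(ℝ, E)) (1 : G))] with g hg hg2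
    simp only [Function.comp_apply, hfe, e.left_inv hg]
    exact (e.left_inv hg2).symm
  rw [Filter.map_congr hsq, ← Filter.map_map, ← Filter.map_map, he1, f.map_nhds_eq hf, hfa, hsymm]

lemma exists_injOn_mul_self
    (E : Type*) [NormedAddCommGroup E] [NormedSpace ℝ E] [FiniteDimensional ℝ E]
    (G : Type*) [TopologicalSpace G] [ChartedSpace E G] [Group G] [LieGroup 𝓘(ℝ, E) ∞ G] :
    ∃ V ∈ 𝓝 (1 : G), Set.InjOn (fun g : G => g * g) V := by
  obtain ⟨f, hf, hfe⟩ := exists_chart_squaring E G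
  set e := extChartAt 𝓘(ℝ, E) (1 : G) with he
  refine ⟨e.source ∩ e ⁻¹' f.source, ?_, ?_⟩
  · exact Filter.inter_mem (extChartAt_source_mem_nhds (1 : G))
      ((continuousAt_extChartAt (1 : G)).preimage_mem_nhds (f.open_source.mem_nhds hf))
  · rintro g ⟨hg, hg'⟩ k ⟨hk, hk'⟩ hgk
    refine e.injOn hg hk (f.injOn hg' hk' ?_)
    rw [hfe]
    simp only [e.left_inv hg, e.left_inv hk]
    exact congrArg e hgk

end Squaring

/-! ### Regularity of the adjoint action. -/

section Adjoint

/-- When the base points do not move, the changes of tangent coordinates are trivial. For `Ad g`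
both base points are `1`. -/
lemma inTangentCoordinates_apply_of_eq {𝕜 : Type*} [NontriviallyNormedField 𝕜]
    {F : Type*} [NormedAddCommGroup F] [NormedSpace 𝕜 F] {F' : Type*} [NormedAddCommGroup F']
    [NormedSpace 𝕜 F'] {H : Type*} [TopologicalSpace H] {H' : Type*} [TopologicalSpace H']
    {I : ModelWithCorners 𝕜 F H} {I' : ModelWithCorners 𝕜 F' H'}
    {M : Type*} [TopologicalSpace M] [ChartedSpace H M] [IsManifold I 1 M]
    {M' : Type*} [TopologicalSpace M'] [ChartedSpace H' M'] [IsManifold I' 1 M'] {N : Type*}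
    {f : N → M} {g : N → M'} (ϕ : N → F →L[𝕜] F') {x₀ x : N} (hf : f x = f x₀)
    (hg : g x = g x₀) (v : F) : inTangentCoordinates I I' f g ϕ x₀ x v = ϕ x v := by
  rw [inTangentCoordinates_eq f g ϕ (by rw [hf]; exact mem_chart_source H _)
    (by rw [hg]; exact mem_chart_source H' _)]
  change tangentCoordChange I' (g x) (g x₀) (g x)
    (ϕ x (tangentCoordChange I (f x₀) (f x) (f x) v)) = ϕ x v
  rw [hf, hg, tangentCoordChange_self (mem_extChartAt_source _),
    tangentCoordChange_self (mem_extChartAt_source _)]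

/-- The orbit map `g ↦ Ad g x`, with values in the model space. -/
def orbitMap (x : GroupLieAlgebra 𝓘(ℝ, E) G) (g : G) : E := Ad g x

lemma contMDiff_orbitMap (x : GroupLieAlgebra 𝓘(ℝ, E) G) :
    ContMDiff 𝓘(ℝ, E) 𝓘(ℝ, E) 1 (orbitMap x) := by
  intro g₀
  have hf : ContMDiff (𝓘(ℝ, E).prod 𝓘(ℝ, E)) 𝓘(ℝ, E) ∞
      (Function.uncurry fun g y : G => g * y * g⁻¹) :=
    (contMDiff_fst.mul contMDiff_snd).mul contMDiff_fst.inv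
  have h := ContMDiffAt.mfderiv_apply (m := 1) (n := ∞) (I := 𝓘(ℝ, E)) (I' := 𝓘(ℝ, E))
    (J := 𝓘(ℝ, E)) (J' := 𝓘(ℝ, E))
    (fun g y : G => g * y * g⁻¹) (fun _ : G => (1 : G)) id
    (fun _ : G => (x : E)) (x₀ := g₀) hf.contMDiffAt contMDiffAt_const contMDiffAt_id
    contMDiffAt_const (by rw [one_add_one_eq_two]; exact ENat.LEInfty.out)
  refine h.congr_of_eventuallyEq (Filter.Eventually.of_forall fun g => ?_)
  refine (inTangentCoordinates_apply_of_eq (I := 𝓘(ℝ, E)) (I' := 𝓘(ℝ, E)) (f := fun _ : G => (1 : G))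
    (g := fun g : G => g * 1 * g⁻¹) (fun g => mfderiv 𝓘(ℝ, E) 𝓘(ℝ, E) (fun y : G => g * y * g⁻¹) 1)
    rfl (by simp) (x : E)).symm

end Adjoint

end

section

open Topology

variable {E : Type*} [NormedAddCommGroup E] [NormedSpace ℝ E]
  {G : Type*} [TopologicalSpace G] [ChartedSpace E G] [Group G] [LieGroup 𝓘(ℝ, E) ∞ G]

/-! ### Local structure of `G^h` at the identity. -/

section Centralizer

lemma mem_centralizer {h : GroupLieAlgebra 𝓘(ℝ, E) G} {g : G} :
    g ∈ centralizer h ↔ Ad g h = h := Iff.rfl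

/-- `Ad g`, as an endomorphism of the model space. -/
def adModel (E : Type*) [NormedAddCommGroup E] [NormedSpace ℝ E] {G : Type*} [TopologicalSpace G]
    [ChartedSpace E G] [Group G] (g : G) : E →L[ℝ] E := Ad (E := E) g

lemma orbitMap_mul (x : GroupLieAlgebra 𝓘(ℝ, E) G) (a b : G) :
    orbitMap x (a * b) = adModel E a (orbitMap x b) :=
  congrArg (fun T => T x) (Ad_mul a b)

lemma centralizerComponent_le (h : GroupLieAlgebra 𝓘(ℝ, E) G) :
    centralizerComponent h ≤ centralizer h := Subgroup.map_subtype_le _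

lemma isPreconnected_orbit (h : GroupLieAlgebra 𝓘(ℝ, E) G) (H : Subgroup G) (m : G ⧸ H) :
    IsPreconnected (MulAction.orbit (centralizerComponent h) m) := by
  have : IsTopologicalGroup G := topologicalGroup_of_lieGroup 𝓘(ℝ, E) ∞
  have h1 : IsPreconnected (centralizerComponent h : Set G) :=
    (isPreconnected_connectedComponent (x := (1 : centralizer h))).image _
      continuous_subtype_val.continuousOn
  have h2 : MulAction.orbit (centralizerComponent h) m
      = (fun k : G => k • m) '' (centralizerComponent h : Set G) := by
    ext y
    constructor
    · rintro ⟨k, rfl⟩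
      exact ⟨k, k.2, rfl⟩
    · rintro ⟨k, hk, rfl⟩
      exact ⟨⟨k, hk⟩, rfl⟩
  rw [h2]
  exact h1.image _ (by fun_prop)

variable [FiniteDimensional ℝ E]

lemma continuous_adModel : Continuous (adModel E : G → E →L[ℝ] E) :=
  continuous_clm_apply.2 fun x => (contMDiff_orbitMap (G := G) x).continuous

/-- If `Ad(v)² h = h`, then `x = Ad(v) h - h` satisfies `Ad(v) x = -x`. This forces `x = 0` once
`‖Ad v - 1‖ < 2`. -/
lemma eventually_mem_centralizer_of_mul_self_mem (h : GroupLieAlgebra 𝓘(ℝ, E) G) :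
    ∀ᶠ v in 𝓝 (1 : G), v * v ∈ centralizer h → v ∈ centralizer h := by
  have h1 : adModel E (1 : G) = ContinuousLinearMap.id ℝ E := Ad_one
  have hc : Filter.Tendsto (fun v : G => ‖adModel E v - ContinuousLinearMap.id ℝ E‖)
      (𝓝 1) (𝓝 0) := by
    have := ((continuous_adModel (E := E) (G := G)).sub continuous_const).norm.tendsto
      (f := fun v : G => ‖adModel E v - ContinuousLinearMap.id ℝ E‖) 1
    simpa [h1] using this
  filter_upwards [hc.eventually (gt_mem_nhds two_pos)] with v hv hvv
  let h' : E := h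
  set x : E := adModel E v h' - h' with hx
  have h2 : adModel E v (adModel E v h') = h' := by
    have h3 : Ad (v * v) h = h := hvv
    rw [Ad_mul] at h3
    exact h3
  have h4 : adModel E v x = -x := by
    rw [hx, map_sub, h2, neg_sub]
  have h5 : (adModel E v - ContinuousLinearMap.id ℝ E) x = (-2 : ℝ) • x := by
    change adModel E v x - x = _
    rw [h4, neg_smul, two_smul, neg_add, sub_eq_add_neg]
  have h6 := (adModel E v - ContinuousLinearMap.id ℝ E).le_opNorm x
  rw [h5, norm_smul, norm_neg, Real.norm_ofNat] at h6
  have h7 : x = 0 := by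
    by_contra hne
    exact absurd (le_of_mul_le_mul_right h6 (norm_pos_iff.2 hne)) (not_le.2 hv)
  exact (sub_eq_zero.1 h7 : adModel E v h' = h')

/-- Equivariance: near `p`, the orbit map is `Ad g` composed with itself near `1` and left
translation by `g⁻¹`, and composing with linear maps cannot raise the rank. -/
lemma finrank_range_fderiv_orbitMap_le (x : GroupLieAlgebra 𝓘(ℝ, E) G) {p : E}
    (hp : p ∈ (extChartAt 𝓘(ℝ, E) (1 : G)).target) :
    Module.finrank ℝ (fderiv ℝ (orbitMap x ∘ (extChartAt 𝓘(ℝ, E) (1 : G)).symm) p).range ≤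
      Module.finrank ℝ (fderiv ℝ (orbitMap x ∘ (extChartAt 𝓘(ℝ, E) (1 : G)).symm)
        (extChartAt 𝓘(ℝ, E) (1 : G) 1)).range := by
  set e := extChartAt 𝓘(ℝ, E) (1 : G) with he
  have hes {q : E} (hq : q ∈ e.target) : ContMDiffAt 𝓘(ℝ, E) 𝓘(ℝ, E) 1 e.symm q :=
    (contMDiffOn_extChartAt_symm (1 : G)).contMDiffAt ((isOpen_extChartAt_target (1 : G)).mem_nhds hq)
  have hs : e.symm (e 1) = 1 := extChartAt_to_inv (1 : G)
  set f : E → E := orbitMap x ∘ e.symm with hf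
  set g := e.symm p with hg
  let κ : E → E := fun q => e (g⁻¹ * e.symm q)
  have hκp : κ p = e 1 := by simp [κ, ← hg]
  have hcm : ContMDiffAt 𝓘(ℝ, E) 𝓘(ℝ, E) 1 (fun q => g⁻¹ * e.symm q) p :=
    contMDiffAt_const.mul (hes hp)
  have hκ : DifferentiableAt ℝ κ p := by
    have h1 : ContMDiffAt 𝓘(ℝ, E) 𝓘(ℝ, E) 1 κ p := by
      refine ContMDiffAt.comp p ?_ hcm
      rw [← hg, inv_mul_cancel]
      exact contMDiffAt_extChartAt
    exact (contMDiffAt_iff_contDiffAt.1 h1).differentiableAt one_ne_zero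
  have hfa : DifferentiableAt ℝ f (κ p) := by
    rw [hκp]
    have h1 : ContMDiffAt 𝓘(ℝ, E) 𝓘(ℝ, E) 1 f (e 1) :=
      (contMDiff_orbitMap x).contMDiffAt.comp _ (hes (mem_extChartAt_target (1 : G)))
    exact (contMDiffAt_iff_contDiffAt.1 h1).differentiableAt one_ne_zero
  have heq : f =ᶠ[𝓝 p] adModel E g ∘ f ∘ κ := by
    have hsrc : ∀ᶠ q in 𝓝 p, g⁻¹ * e.symm q ∈ e.source := by
      refine hcm.continuousAt.eventually (p := (· ∈ e.source)) ?_
      simp only [← hg, inv_mul_cancel]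
      exact extChartAt_source_mem_nhds (1 : G)
    filter_upwards [hsrc] with q hq
    simp only [hf, κ, Function.comp_apply, e.left_inv hq]
    rw [← orbitMap_mul, mul_inv_cancel_left]
  have hd : fderiv ℝ f p = adModel E g ∘L fderiv ℝ f (e 1) ∘L fderiv ℝ κ p := by
    rw [heq.fderiv_eq, ← hκp]
    exact ((adModel E g).hasFDerivAt.comp p (hfa.hasFDerivAt.comp p hκ.hasFDerivAt)).fderiv
  rw [hd]
  have h1 : ((adModel E g ∘L fderiv ℝ f (e 1) ∘L fderiv ℝ κ p : E →L[ℝ] E) : E →ₗ[ℝ] E).range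
      ≤ ((fderiv ℝ f (e 1)).range).map (adModel E g).toLinearMap := by
    rintro _ ⟨v, rfl⟩
    exact ⟨fderiv ℝ f (e 1) (fderiv ℝ κ p v), ⟨_, rfl⟩, rfl⟩
  exact (Submodule.finrank_mono h1).trans (Submodule.finrank_map_le _ _)

/-- `G^h` is the level set of the orbit map through `1`, so the constant rank theorem joins nearby
elements of `G^h` to `1` inside `G^h`. -/
lemma eventually_mem_centralizerComponent (h : GroupLieAlgebra 𝓘(ℝ, E) G) :
    ∀ᶠ v in 𝓝 (1 : G), v ∈ centralizer h → v ∈ centralizerComponent h := by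
  set e := extChartAt 𝓘(ℝ, E) (1 : G) with he
  have hs : e.symm (e 1) = 1 := extChartAt_to_inv (1 : G)
  have hfa : ContDiffAt ℝ 1 (orbitMap h ∘ e.symm) (e 1) :=
    contMDiffAt_iff_contDiffAt.1 ((contMDiff_orbitMap h).contMDiffAt.comp _
      ((contMDiffOn_extChartAt_symm (1 : G)).contMDiffAt (extChartAt_target_mem_nhds (1 : G))))
  have ht : e.target ∈ 𝓝 (e 1) := extChartAt_target_mem_nhds (1 : G)
  have key := eventually_joinedIn_level_of_rank_le hfa
    (Filter.mem_of_superset ht fun p hp => finrank_range_fderiv_orbitMap_le h hp) ht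
  filter_upwards [(continuousAt_extChartAt (1 : G)).eventually key,
    extChartAt_source_mem_nhds (I := 𝓘(ℝ, E)) (1 : G)] with v hv hvs hvc
  have hlev {g : G} : orbitMap h g = orbitMap h 1 ↔ g ∈ centralizer h := by
    have h1 : orbitMap h (1 : G) = (h : E) := congrArg (fun T => T h) Ad_one
    rw [h1]
    rfl
  have hj := hv (by simp only [Function.comp_apply, ← he, hs, e.left_inv hvs]; exact hlev.2 hvc)
  have hj2 : JoinedIn (centralizer h : Set G) 1 v := by
    have h3 := hj.map_continuousOn (f := e.symm) ((continuousOn_extChartAt_symm (1 : G)).mono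
      Set.inter_subset_left)
    rw [← he, hs, e.left_inv hvs] at h3
    refine h3.mono ?_
    rintro _ ⟨q, ⟨-, hq⟩, rfl⟩
    simp only [Set.mem_ofPred_eq, Function.comp_apply, hs] at hq
    exact hlev.1 hq
  have hj3 := (joinedIn_iff_joined (centralizer h).one_mem hvc).1 hj2
  exact ⟨⟨v, hvc⟩, pathComponent_subset_component _ hj3, rfl⟩

end Centralizer

/-! ### Orbits of `G^h_e` as connected components. -/

section Orbits

variable [FiniteDimensional ℝ E]

lemma lieMap_Ad {τ : G →* G} (hτ : ContMDiff 𝓘(ℝ, E) 𝓘(ℝ, E) ∞ τ) (a : G)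
    (x : GroupLieAlgebra 𝓘(ℝ, E) G) : lieMap τ (Ad a x) = Ad (τ a) (lieMap τ x) := by
  refine eq_of_forall_lieExp_smul_eq fun t => ?_
  rw [← map_lieExp_smul τ hτ, ← conj_lieExp_smul, ← conj_lieExp_smul, ← map_lieExp_smul τ hτ,
    map_mul, map_mul, map_inv]

/-- Since `τ h = h`, applying `τ` to `Ad(a)⁻¹h` gives `Ad(τ a)⁻¹h`. -/
lemma Ad_inv_mem_fixedLie_iff {τ : G →* G} (hτ : ContMDiff 𝓘(ℝ, E) 𝓘(ℝ, E) ∞ τ)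
    {h : GroupLieAlgebra 𝓘(ℝ, E) G} (hh : h ∈ fixedLie τ) (a : G) :
    Ad a⁻¹ h ∈ fixedLie τ ↔ a * (τ a)⁻¹ ∈ centralizer h := by
  have hh' : lieMap τ h = h := hh
  change lieMap τ (Ad a⁻¹ h) = Ad a⁻¹ h ↔ Ad (a * (τ a)⁻¹) h = h
  rw [lieMap_Ad hτ, hh', map_inv, Ad_mul, ContinuousLinearMap.comp_apply]
  have hinv (b : G) (x : GroupLieAlgebra 𝓘(ℝ, E) G) : Ad b (Ad b⁻¹ x) = x ∧ Ad b⁻¹ (Ad b x) = x := by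
    constructor <;> rw [← ContinuousLinearMap.comp_apply, ← Ad_mul] <;> simp [Ad_one]
  constructor
  · intro h1
    rw [h1, (hinv a h).1]
  · intro h1
    rw [← (hinv a (Ad (τ a)⁻¹ h)).2, h1]

lemma smul_mem_fixedSet {h : GroupLieAlgebra 𝓘(ℝ, E) G} {H : Subgroup G} {k : G}
    (hk : k ∈ centralizer h) {m : G ⧸ H} (hm : m ∈ fixedSet h H) : k • m ∈ fixedSet h H := by
  intro t
  have h1 : k * lieExp (t • h) * k⁻¹ = lieExp (t • h) := by
    rw [conj_lieExp_smul, mem_centralizer.1 hk]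
  have h2 : lieExp (t • h) • m = m := hm t
  change lieExp (t • h) • k • m = k • m
  rw [smul_smul, ← h1, inv_mul_cancel_right, mul_smul, h2]

lemma eventually_mem_orbit {τ : G →* G} (hτ : ContMDiff 𝓘(ℝ, E) 𝓘(ℝ, E) ∞ τ)
    (hττ : ∀ g, τ (τ g) = g) {H : Subgroup G} (hH_le : H ≤ fixedGroup τ)
    (hH_open : IsOpen (H.subgroupOf (fixedGroup τ) : Set (fixedGroup τ)))
    {h : GroupLieAlgebra 𝓘(ℝ, E) G} (hh : h ∈ fixedLie τ) {m : G ⧸ H} (hm : m ∈ fixedSet h H) :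
    ∀ᶠ y in 𝓝[fixedSet h H] m, y ∈ MulAction.orbit (centralizerComponent h) m := by
  have : IsTopologicalGroup G := topologicalGroup_of_lieGroup 𝓘(ℝ, E) ∞
  rw [eventually_nhdsWithin_iff]
  induction m using QuotientGroup.induction_on with
  | _ g =>
  -- Moves the base point to `gH`: the fixed group of `σ` is `g G^τ g⁻¹`, in which the stabilizer `g
  -- H g⁻¹` is open.
  let σ : G →* G :=
    (MulAut.conj g).toMonoidHom.comp (τ.comp (MulAut.conj g⁻¹).toMonoidHom)
  have hσa (u : G) : σ u = g * τ (g⁻¹ * u * g) * g⁻¹ := by simp [σ]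
  have hσ : Continuous σ := by
    have hτc : Continuous τ := hτ.continuous
    have : ⇑σ = fun u => g * τ (g⁻¹ * u * g) * g⁻¹ := funext hσa
    rw [this]
    fun_prop
  have hσσ (u : G) : σ (σ u) = u := by
    rw [hσa, hσa]
    have : g⁻¹ * (g * τ (g⁻¹ * u * g) * g⁻¹) * g = τ (g⁻¹ * u * g) := by group
    rw [this, hττ]
    group
  have hK : ∀ᶠ v in 𝓝 (1 : G), v * v ∈ (centralizer h : Set G) →
      v ∈ (centralizerComponent h : Set G) := by
    filter_upwards [eventually_mem_centralizer_of_mul_self_mem h,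
      eventually_mem_centralizerComponent h] with v h1 h2 h3
    exact h2 (h1 h3)
  have hHτ : ∀ᶠ k in 𝓝 (1 : G), τ k = k → k ∈ H := by
    have h1 : ∀ᶠ k : fixedGroup τ in 𝓝 1, (k : G) ∈ H :=
      hH_open.mem_nhds (H.subgroupOf (fixedGroup τ)).one_mem
    rw [nhds_subtype_eq_comap, Filter.eventually_comap] at h1
    exact h1.mono fun k hk hkτ => hk ⟨k, hkτ⟩ rfl
  have hH : ∀ᶠ k in 𝓝 (1 : G), σ k = k → k ∈ {k : G | g⁻¹ * k * g ∈ H} := by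
    have hc : Filter.Tendsto (fun k : G => g⁻¹ * k * g) (𝓝 1) (𝓝 1) := by
      have : Continuous fun k : G => g⁻¹ * k * g := by fun_prop
      simpa using this.tendsto 1
    filter_upwards [hc.eventually hHτ] with k hk hkσ
    refine hk ?_
    rw [hσa] at hkσ
    nth_rw 2 [← hkσ]
    group
  have key := eventually_exists_mul_fixed hσ hσσ (map_mul_self_nhds_one E G)
    (exists_injOn_mul_self E G) hK hH
  have hg := (Ad_inv_mem_fixedLie_iff hτ hh g).1 ((mk_mem_fixedSet_iff hτ hH_le hH_open h g).1 hm)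
  have hnhds : 𝓝 (g : G ⧸ H) = Filter.map (fun u : G => ((u * g : G) : G ⧸ H)) (𝓝 1) := by
    have h1 : 𝓝 g = Filter.map (fun u : G => u * g) (𝓝 1) := by
      simp
    rw [QuotientGroup.nhds_eq, h1, Filter.map_map]
    rfl
  rw [hnhds, Filter.eventually_map]
  filter_upwards [key] with u hu hum
  have h1 := (Ad_inv_mem_fixedLie_iff hτ hh (u * g)).1
    ((mk_mem_fixedSet_iff hτ hH_le hH_open h (u * g)).1 hum)
  -- Both factors lie in `G^h`, because `ugH` and `gH` are fixed points.
  have h2 : u * (σ u)⁻¹ = (u * g * (τ (u * g))⁻¹) * (g * (τ g)⁻¹)⁻¹ := by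
    rw [hσa]
    simp only [map_mul, map_inv]
    group
  obtain ⟨v, hv, hvu⟩ := hu (h2 ▸ (centralizer h).mul_mem h1 ((centralizer h).inv_mem hg))
  refine ⟨⟨v, hv⟩, ?_⟩
  change ((v * g : G) : G ⧸ H) = ((u * g : G) : G ⧸ H)
  rw [QuotientGroup.eq]
  have h3 : g⁻¹ * (v⁻¹ * u) * g ∈ H := hvu
  convert h3 using 1
  group

lemma orbit_eq_connectedComponentIn {τ : G →* G} (hτ : ContMDiff 𝓘(ℝ, E) 𝓘(ℝ, E) ∞ τ)
    (hττ : ∀ g, τ (τ g) = g) {H : Subgroup G} (hH_le : H ≤ fixedGroup τ)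
    (hH_open : IsOpen (H.subgroupOf (fixedGroup τ) : Set (fixedGroup τ)))
    {h : GroupLieAlgebra 𝓘(ℝ, E) G} (hh : h ∈ fixedLie τ) {m : G ⧸ H} (hm : m ∈ fixedSet h H) :
    MulAction.orbit (centralizerComponent h) m = connectedComponentIn (fixedSet h H) m := by
  refine Set.Subset.antisymm ?_ fun y hy => ?_
  · refine (isPreconnected_orbit h H m).subset_connectedComponentIn (MulAction.mem_orbit_self m) ?_
    rintro _ ⟨k, rfl⟩
    exact smul_mem_fixedSet (centralizerComponent_le h k.2) hm
  · have hsub := connectedComponentIn_subset (fixedSet h H) m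
    -- Lying in the same orbit is an equivalence relation with relatively open classes, so a
    -- connected set of fixed points meets only one class.
    refine isPreconnected_connectedComponentIn.induction₂
      (fun a b => b ∈ MulAction.orbit (centralizerComponent h) a) (fun a ha => ?_)
      (fun a b c ha hb hc hab hbc => ?_) (fun a b ha hb hab => ?_)
      (mem_connectedComponentIn hm) hy
    · exact (eventually_mem_orbit hτ hττ hH_le hH_open hh (hsub ha)).filter_mono
        (nhdsWithin_mono a hsub)
    · rwa [← MulAction.orbit_eq_iff.2 hab]
    · exact MulAction.mem_orbit_symm.1 hab

end Orbits

end

end ModularFlow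

end

theorem proposition5p3
    {E : Type*} [NormedAddCommGroup E] [NormedSpace ℝ E] [FiniteDimensional ℝ E]
    {G : Type*} [TopologicalSpace G] [ChartedSpace E G] [Group G] [LieGroup 𝓘(ℝ, E) ∞ G]
    [ConnectedSpace G]
    (τ : G →* G) (hτ_smooth : ContMDiff 𝓘(ℝ, E) 𝓘(ℝ, E) ∞ τ) (hτ_invol : ∀ g, τ (τ g) = g)
    (H : Subgroup G) (hH_le : H ≤ ModularFlow.fixedGroup τ)
    (hH_open : IsOpen (H.subgroupOf (ModularFlow.fixedGroup τ) : Set (ModularFlow.fixedGroup τ)))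
    (h : GroupLieAlgebra 𝓘(ℝ, E) G) (hh_euler : ModularFlow.IsEulerElement h)
    (hh_fixed : h ∈ ModularFlow.fixedLie τ) :
    ModularFlow.fixedSet h H
        = {m | ∃ g : G, (g : G ⧸ H) = m ∧ ModularFlow.Ad g⁻¹ h ∈ ModularFlow.fixedLie τ} ∧
      ModularFlow.fixedSet h H = {m | ModularFlow.modularVectorField h H m = 0} ∧
      ∀ m ∈ ModularFlow.fixedSet h H,
        MulAction.orbit (ModularFlow.centralizerComponent h) m
          = connectedComponentIn (ModularFlow.fixedSet h H) m := by
  exact ⟨ModularFlow.fixedSet_eq hτ_smooth hH_le hH_open h,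
    ModularFlow.fixedSet_eq_modularVectorField hτ_smooth hH_le hH_open h,
    fun m hm => ModularFlow.orbit_eq_connectedComponentIn hτ_smooth hτ_invol hH_le hH_open
      hh_fixed hm⟩
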